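/- Let $n\ge 1$ and let $\mathbb V=(V_1,\dots,V_n)$ be an $n$-tuple of pairwise commuting shifts on a complex Hilbert space $\mathcal H$, where a shift is a linear isometry $V$ of $\mathcal H$ with $\bigcap_{j\ge 0}V^j\mathcal H=\{0\}$. Let $\operatorname{Ann}(\mathbb V)=\{p\in\mathbb C[X_1,\dots,X_n] : p(\mathbb V)=0\}$, and suppose that the affine algebraic variety $Z(\operatorname{Ann}(\mathbb V))=\{z\in\mathbb C^n : p(z)=0 \text{ for all } p\in\operatorname{Ann}(\mathbb V)\}$ has dimension $1$. Then the following assertions are equivalent. 1. There is a finite cyclic set for $\mathbb V$, that is, a finite set $S\subseteq\mathcal H$ such that the vectors $p(\mathbb V)h$, with $p\in\mathbb C[X_1,\dots,X_n]$ and $h\in S$, span a dense linear subspace of $\mathcal H$. 2. $V_i$ has finite multiplicity, that is, $\dim\ker V_i^*<\infty$, for every $i\in\{1,\dots,n\}$. 3. $V_i$ has finite multiplicity for at least one $i\in\{1,\dots,n\}$. -/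

import Mathlib

noncomputable section

namespace CommutingShifts

variable {n : ℕ} {H : Type*} [NormedAddCommGroup H] [InnerProductSpace ℂ H]

/-- A bounded operator `V` on `H` is a shift if it is an isometry and `⋂ j, V ^ j H = {0}`. -/
structure IsShift (V : H →L[ℂ] H) : Prop where
  isometry : ∀ x, ‖V x‖ = ‖x‖
  iInf_range_pow : (⨅ j : ℕ, LinearMap.range (V ^ j).toLinearMap) = ⊥

/-- `V` has finite multiplicity: the multiplicity `dim ker V*` is finite. -/
def HasFiniteMultiplicity [CompleteSpace H] (V : H →L[ℂ] H) : Prop :=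
  FiniteDimensional ℂ (LinearMap.ker (ContinuousLinearMap.adjoint V).toLinearMap)

theorem pairwise_commute_pow (V : Fin n → H →L[ℂ] H) (hV : ∀ i j, Commute (V i) (V j))
    (α : Fin n →₀ ℕ) :
    ((Finset.univ : Finset (Fin n)) : Set (Fin n)).Pairwise
      (Function.onFun Commute fun i => V i ^ (α i)) :=
  fun i _ j _ _ => (hV i j).pow_pow _ _

/-- For a commuting tuple, the monomial operators `V ^ α = V₁ ^ α₁ ⋯ Vₙ ^ αₙ`, as a
homomorphism from the (multiplicatively written) monoid of exponents. -/
def opMonomial (V : Fin n → H →L[ℂ] H) (hV : ∀ i j, Commute (V i) (V j)) :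
    Multiplicative (Fin n →₀ ℕ) →* (H →L[ℂ] H) where
  toFun α := Finset.univ.noncommProd (fun i => V i ^ (α.toAdd i))
    (pairwise_commute_pow V hV α.toAdd)
  map_one' := by
    refine (Finset.noncommProd_eq_pow_card _ _ _ 1 ?_).trans (one_pow _)
    intro i _
    simp
  map_mul' α β := by
    refine (Finset.noncommProd_congr rfl (fun i _ => ?_) _).trans
      (Finset.noncommProd_mul_distrib (fun i => V i ^ (α.toAdd i)) (fun i => V i ^ (β.toAdd i))
        (pairwise_commute_pow V hV α.toAdd) (pairwise_commute_pow V hV β.toAdd)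
        (fun i _ j _ _ => (hV i j).pow_pow _ _))
    simp [pow_add]

/-- The evaluation `p ↦ p(V) = p(V₁, …, Vₙ)` at a tuple of commuting operators, i.e. the linear
extension of `X ^ α ↦ V ^ α`. (`MvPolynomial.aeval` is not available, since the
algebra of operators is not commutative.) -/
def polyEval (V : Fin n → H →L[ℂ] H) (hV : ∀ i j, Commute (V i) (V j)) :
    MvPolynomial (Fin n) ℂ →ₐ[ℂ] (H →L[ℂ] H) :=
  AddMonoidAlgebra.lift ℂ (H →L[ℂ] H) (Fin n →₀ ℕ) (opMonomial V hV)

theorem polyEval_monomial (V : Fin n → H →L[ℂ] H) (hV : ∀ i j, Commute (V i) (V j))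
    (α : Fin n →₀ ℕ) (c : ℂ) :
    polyEval V hV (MvPolynomial.monomial α c) =
      c • Finset.univ.noncommProd (fun i => V i ^ (α i))
        (pairwise_commute_pow V hV α) :=
  AddMonoidAlgebra.lift_single _ _ _

theorem polyEval_X (V : Fin n → H →L[ℂ] H) (hV : ∀ i j, Commute (V i) (V j)) (i : Fin n) :
    polyEval V hV (MvPolynomial.X i) = V i := by
  rw [MvPolynomial.X, polyEval_monomial, one_smul]
  refine (Finset.mul_noncommProd_erase Finset.univ (Finset.mem_univ i) _ _).symm.trans ?_
  refine (congrArg _ (Finset.noncommProd_eq_pow_card (Finset.univ.erase i) _ _ 1 ?_)).trans ?_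
  · intro j hj
    rw [Finsupp.single_eq_of_ne (Finset.ne_of_mem_erase hj), pow_zero]
  · rw [one_pow, mul_one, Finsupp.single_eq_same, pow_one]

/-- The annihilator `Ann(V)`: the ideal of all polynomials `p` with `p(V) = 0`. -/
def annihilator (V : Fin n → H →L[ℂ] H) (hV : ∀ i j, Commute (V i) (V j)) :
    Ideal (MvPolynomial (Fin n) ℂ) :=
  RingHom.ker (polyEval V hV)

/-- The dimension of an algebraic set `W ⊆ ℂⁿ`: the Krull dimension of its coordinate ring
`ℂ[X₁, …, Xₙ] / I(W)`, where `I(W)` is the ideal of all polynomials vanishing on `W`. -/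
def varietyDim (W : Set (Fin n → ℂ)) : WithBot ℕ∞ :=
  ringKrullDim (MvPolynomial (Fin n) ℂ ⧸ MvPolynomial.vanishingIdeal ℂ W)

/-- `S` is cyclic for the tuple `V`: the vectors `p(V) h`, with `p` a polynomial and `h ∈ S`, span
a dense subspace of `H`. -/
def IsCyclicSet (V : Fin n → H →L[ℂ] H) (hV : ∀ i j, Commute (V i) (V j)) (S : Set H) : Prop :=
  (Submodule.span ℂ {x : H | ∃ p : MvPolynomial (Fin n) ℂ, ∃ h ∈ S,
    x = polyEval V hV p h}).topologicalClosure = ⊤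

end CommutingShifts

end

noncomputable section

namespace CommutingShifts

open MvPolynomial

/-! The implication 1 → 2 is where the dimension matters. As `V i` is injective, `X i` is a
non-zero-divisor modulo `Ann(V)`, so dividing the one-dimensional ring `ℂ[X] / Ann(V)` by `X i`
leaves a finite-dimensional algebra. The projection onto `ker (V i)*` kills the range of `V i`, so
each cyclic vector contributes only a finite-dimensional piece of that kernel, and finitely many
pieces fill it. For 3 → 1, the Wold decomposition makes a finite spanning set of `ker (V i)*` cyclic
already under powers of `V i`. -/

/-- Passing to the variety of an ideal does not change the dimension. -/
theorem varietyDim_zeroLocus {n : ℕ} (I : Ideal (MvPolynomial (Fin n) ℂ)) :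
    varietyDim (zeroLocus ℂ I) = ringKrullDim (MvPolynomial (Fin n) ℂ ⧸ I) := by
  -- Nullstellensatz; an ideal and its radical lie in the same primes.
  rw [varietyDim, vanishingIdeal_zeroLocus_eq_radical, ringKrullDim_quotient,
    ringKrullDim_quotient, PrimeSpectrum.zeroLocus_radical]

/-- If `ℂ[X₁, …, Xₙ] / I` has dimension at most one and `x` is a non-zero-divisor modulo `I`, then
`ℂ[X₁, …, Xₙ] / (I + (x))` is finite-dimensional. -/
theorem finite_quotient_sup_span_singleton {n : ℕ} (I : Ideal (MvPolynomial (Fin n) ℂ))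
    (hI : ringKrullDim (MvPolynomial (Fin n) ℂ ⧸ I) ≤ 1) (x : MvPolynomial (Fin n) ℂ)
    (hx : ∀ p, x * p ∈ I → p ∈ I) :
    Module.Finite ℂ (MvPolynomial (Fin n) ℂ ⧸ (I ⊔ Ideal.span {x})) := by
  set R := MvPolynomial (Fin n) ℂ ⧸ I
  have hreg : Ideal.Quotient.mk I x ∈ nonZeroDivisors R := by
    rw [mem_nonZeroDivisors_iff_left]
    intro y hy
    obtain ⟨p, rfl⟩ := Ideal.Quotient.mk_surjective y
    rw [← map_mul, Ideal.Quotient.eq_zero_iff_mem] at hy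
    exact Ideal.Quotient.eq_zero_iff_mem.2 (hx p hy)
  -- The bound `≤ 0` also covers the zero ring, of dimension `⊥`.
  have hdim : ringKrullDim (R ⧸ Ideal.span {Ideal.Quotient.mk I x}) ≤ 0 := by
    have h := (ringKrullDim_quotient_succ_le_of_nonZeroDivisor hreg).trans hI
    exact ENat.WithBot.lt_add_one_iff (m := 0).1 (by
      simpa using ENat.WithBot.add_one_le_natCast_iff (m := 1).1 (by exact_mod_cast h))
  have himage : (Ideal.span {x}).map (Ideal.Quotient.mk I) =
      Ideal.span {Ideal.Quotient.mk I x} := by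
    rw [Ideal.map_span, Set.image_singleton]
  rw [← himage, ringKrullDim_eq_of_ringEquiv (DoubleQuot.quotQuotEquivQuotSup I (Ideal.span {x}))]
    at hdim
  refine (Module.finite_iff_krullDimLE_zero ℂ
    (MvPolynomial (Fin n) ℂ ⧸ (I ⊔ Ideal.span {x}))).2 (Ring.krullDimLE_iff.2 ?_)
  exact_mod_cast hdim

variable {n : ℕ} {H : Type*} [NormedAddCommGroup H] [InnerProductSpace ℂ H]

theorem IsShift.isClosed_range [CompleteSpace H] {V : H →L[ℂ] H} (h : IsShift V) :
    IsClosed (V.range : Set H) := by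
  have hiso : Isometry V := AddMonoidHomClass.isometry_of_norm V h.isometry
  exact hiso.isClosedEmbedding.isClosed_range

theorem IsShift.injective {V : H →L[ℂ] H} (h : IsShift V) : Function.Injective V :=
  (AddMonoidHomClass.isometry_of_norm V h.isometry).injective

theorem IsShift.inner_map_map {V : H →L[ℂ] H} (h : IsShift V) (x y : H) :
    inner ℂ (V x) (V y) = inner ℂ x y :=
  LinearIsometry.inner_map_map ⟨V.toLinearMap, h.isometry⟩ x y

theorem IsShift.inner_pow_map_map {V : H →L[ℂ] H} (h : IsShift V) (k : ℕ) (x y : H) :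
    inner ℂ ((V ^ k) x) ((V ^ k) y) = inner ℂ x y := by
  induction k with
  | zero => simp
  | succ k ih => rw [pow_succ', mul_apply_eq_comp, mul_apply_eq_comp,
      h.inner_map_map, ih]

/-- Wold decomposition: a vector orthogonal to all `V ^ k (ker V*)` vanishes. -/
theorem IsShift.eq_zero_of_forall_inner_pow_eq_zero [CompleteSpace H] {V : H →L[ℂ] H}
    (h : IsShift V) {x : H}
    (hx : ∀ k : ℕ, ∀ e ∈ (ContinuousLinearMap.adjoint V).ker, inner ℂ ((V ^ k) e) x = 0) :
    x = 0 := by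
  have hmem : ∀ k : ℕ, ∃ y, (V ^ k) y = x := by
    intro k
    induction k with
    | zero => exact ⟨x, by simp⟩
    | succ k ih =>
      obtain ⟨y, hy⟩ := ih
      -- `V ^ k` preserves inner products, so `y` is orthogonal to `ker V*`. As the range of `V` is
      -- closed, `y` lies in it, which gains one more power.
      have hy' : y ∈ (ContinuousLinearMap.adjoint V).kerᗮ := by
        intro e he
        rw [← h.inner_pow_map_map k, hy]
        exact hx k e he
      rw [ContinuousLinearMap.orthogonal_ker, ContinuousLinearMap.adjoint_adjoint,
        h.isClosed_range.submodule_topologicalClosure_eq] at hy'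
      obtain ⟨z, rfl⟩ := hy'
      exact ⟨z, by rw [pow_succ]; exact hy⟩
  have : x ∈ (⨅ j : ℕ, LinearMap.range (V ^ j).toLinearMap) :=
    (Submodule.mem_iInf _).2 hmem
  rwa [h.iInf_range_pow, Submodule.mem_bot] at this

/-- A commuting tuple of operators containing a shift of finite multiplicity has a finite
cyclic set. -/
theorem exists_finite_isCyclicSet [CompleteSpace H] (V : Fin n → H →L[ℂ] H)
    (hV : ∀ i j, Commute (V i) (V j)) (i : Fin n) (hi : IsShift (V i))
    (hfin : HasFiniteMultiplicity (V i)) : ∃ S : Set H, S.Finite ∧ IsCyclicSet V hV S := by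
  obtain ⟨s, hs⟩ := (Submodule.fg_iff_finiteDimensional _).2 hfin
  refine ⟨s, s.finite_toSet, ?_⟩
  rw [IsCyclicSet, Submodule.topologicalClosure_eq_top_iff, Submodule.eq_bot_iff]
  intro x hx
  refine hi.eq_zero_of_forall_inner_pow_eq_zero fun k e he => hx _ ?_
  change e ∈ LinearMap.ker (ContinuousLinearMap.adjoint (V i)).toLinearMap at he
  rw [← hs] at he
  refine Submodule.span_induction (fun e he => Submodule.subset_span ⟨X i ^ k, e, he, ?_⟩)
    ?_ (fun a b _ _ ha hb => ?_) (fun c a _ ha => ?_) he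
  · rw [map_pow, polyEval_X]
  · simp
  · rw [map_add]
    exact add_mem ha hb
  · rw [map_smul]
    exact Submodule.smul_mem _ _ ha

/-- If `V` has a finite cyclic set and `Ann(V) + (Xᵢ)` has finite codimension, then `ker Vᵢ*` is
finite-dimensional. -/
theorem hasFiniteMultiplicity_of_isCyclicSet [CompleteSpace H] (V : Fin n → H →L[ℂ] H)
    (hV : ∀ i j, Commute (V i) (V j)) {S : Set H} (hS : S.Finite) (hcyc : IsCyclicSet V hV S)
    (i : Fin n)
    [Module.Finite ℂ (MvPolynomial (Fin n) ℂ ⧸ (annihilator V hV ⊔ Ideal.span {X i}))] :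
    HasFiniteMultiplicity (V i) := by
  set J : Ideal (MvPolynomial (Fin n) ℂ) := annihilator V hV ⊔ Ideal.span {X i}
  set K := (ContinuousLinearMap.adjoint (V i)).ker with hK
  have hKc : IsClosed (K : Set H) := (ContinuousLinearMap.adjoint (V i)).isClosed_ker
  have : CompleteSpace K := hKc.completeSpace_coe
  let P : H →L[ℂ] K := K.orthogonalProjectionOnto
  have hPV : ∀ y, P (V i y) = 0 := by
    intro y
    refine Submodule.orthogonalProjectionOnto_apply_of_mem_orthogonal ?_
    rw [hK, ContinuousLinearMap.orthogonal_ker, ContinuousLinearMap.adjoint_adjoint]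
    exact Submodule.le_topologicalClosure _ ⟨y, rfl⟩
  let Φ : H → MvPolynomial (Fin n) ℂ →ₗ[ℂ] K := fun h =>
    P.toLinearMap ∘ₗ (ContinuousLinearMap.apply ℂ H h).toLinearMap ∘ₗ (polyEval V hV).toLinearMap
  have hΦ : ∀ h p, Φ h p = P (polyEval V hV p h) := fun _ _ => rfl
  have hJ : ∀ h, J.restrictScalars ℂ ≤ LinearMap.ker (Φ h) := by
    intro h p hp
    obtain ⟨a, ha, b, hb, rfl⟩ := Submodule.mem_sup.1 hp
    obtain ⟨q, rfl⟩ := Ideal.mem_span_singleton.1 hb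
    have ha' : polyEval V hV a = 0 := ha
    rw [LinearMap.mem_ker, hΦ, map_add, map_mul, ha', polyEval_X, zero_add,
      mul_apply_eq_comp, hPV]
  have hfin : ∀ h, FiniteDimensional ℂ (LinearMap.range (Φ h)) := by
    intro h
    have : Module.Finite ℂ (MvPolynomial (Fin n) ℂ ⧸ J.restrictScalars ℂ) :=
      inferInstanceAs (Module.Finite ℂ (MvPolynomial (Fin n) ℂ ⧸ J))
    rw [← Submodule.range_liftQ _ _ (hJ h)]
    infer_instance
  have := hS.to_subtype
  let F : Submodule ℂ K := ⨆ h : S, LinearMap.range (Φ h)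
  have hF : FiniteDimensional ℂ F := Submodule.finiteDimensional_iSup _
  -- `F` is finite-dimensional, hence closed, so its preimage under `P` contains the closure of the
  -- cyclic span.
  have hle : (⊤ : Submodule ℂ H) ≤ F.comap P.toLinearMap := by
    rw [← hcyc]
    refine Submodule.topologicalClosure_minimal _ (Submodule.span_le.2 ?_)
      (F.closed_of_finiteDimensional.preimage P.continuous)
    rintro _ ⟨p, h, hh, rfl⟩
    exact Submodule.mem_iSup_of_mem (p := fun h : S => LinearMap.range (Φ h)) ⟨h, hh⟩ ⟨p, rfl⟩
  have htop : F = ⊤ := by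
    refine eq_top_iff.2 fun y _ => ?_
    have hy : P (y : H) ∈ F := hle (x := (y : H)) trivial
    rwa [Submodule.orthogonalProjectionOnto_mem_subspace_eq_self] at hy
  rw [htop] at hF
  exact Module.Finite.equiv (Submodule.topEquiv (R := ℂ) (M := K))

end CommutingShifts

end

theorem theorem6p2 {n : ℕ} {H : Type*} [NormedAddCommGroup H] [InnerProductSpace ℂ H]
    [CompleteSpace H] (V : Fin n → H →L[ℂ] H) (hV : ∀ i j, Commute (V i) (V j))
    (hshift : ∀ i, CommutingShifts.IsShift (V i))
    (hdim : CommutingShifts.varietyDim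
      (MvPolynomial.zeroLocus ℂ (CommutingShifts.annihilator V hV)) = 1) :
    List.TFAE
      [∃ S : Set H, S.Finite ∧ CommutingShifts.IsCyclicSet V hV S,
       ∀ i, CommutingShifts.HasFiniteMultiplicity (V i),
       ∃ i, CommutingShifts.HasFiniteMultiplicity (V i)] := by
  rw [CommutingShifts.varietyDim_zeroLocus] at hdim
  -- For `n = 0` the polynomial ring is a field, of dimension 0 < 1.
  have hn : Nonempty (Fin n) := by
    by_contra hempty
    rw [not_nonempty_iff] at hempty
    have h := ringKrullDim_quotient_le (CommutingShifts.annihilator V hV)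
    rw [hdim, MvPolynomial.ringKrullDim_of_isNoetherianRing, ringKrullDim_eq_zero_of_field,
      Nat.card_of_isEmpty] at h
    norm_num at h
  tfae_have 1 → 2 := by
    rintro ⟨S, hS, hcyc⟩ i
    have := CommutingShifts.finite_quotient_sup_span_singleton (CommutingShifts.annihilator V hV)
      hdim.le (MvPolynomial.X i) fun p hp => by
        change CommutingShifts.polyEval V hV (MvPolynomial.X i * p) = 0 at hp
        change CommutingShifts.polyEval V hV p = 0
        rw [map_mul, CommutingShifts.polyEval_X] at hp
        ext x
        exact (hshift i).injective ((DFunLike.congr_fun hp x).trans (map_zero (V i)).symm)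
    exact CommutingShifts.hasFiniteMultiplicity_of_isCyclicSet V hV hS hcyc i
  tfae_have 2 → 3 := fun h => hn.elim fun i => ⟨i, h i⟩
  tfae_have 3 → 1 := fun ⟨i, hi⟩ =>
    CommutingShifts.exists_finite_isCyclicSet V hV i (hshift i) hi
  tfae_finish
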